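/- Let $m\ge 1$, $n \ge 1$, $\gamma>0$. Write $\triangle^m=\{p\in\mathbb{R}^m_+:\langle p,\mathbf 1\rangle=1\}$, $b\triangle^m=\{t\in\mathbb{R}^m_+:\langle t,\mathbf 1\rangle=b\}$ for a real $b\ge 0$, and let $\delta_K$ be the indicator function of a set $K$ ($0$ on $K$, $+\infty$ elsewhere). The conjugate of $f:\mathbb{R}^m\to\mathbb{R}\cup\{\infty\}$ is $f^*(s)=\sup_{t\in\operatorname{dom} f}\langle s,t\rangle-f(t)$. For $\Omega:\mathbb{R}^m\to\mathbb{R}_+\cup\{\infty\}$ put $\Omega_+^*=(\Omega+\delta_{\mathbb{R}^m_+})^*$ and $\Omega_b^*=(\Omega+\delta_{b\triangle^m})^*$. For $a\in\mathbb{R}^m$, $b\in\mathbb{R}^n$ and $C\in\mathbb{R}^{m\times n}_+$ with columns $c_1,\dots,c_n$, let $\mathcal U(a,b)=\{T\in\mathbb{R}_+^{m\times n}: T\mathbf 1_n=a,\ T^\top\mathbf 1_m=b\}$ and, with $t_j$ the columns of $T$, $$P_\Omega(a,b,C)=\inf_{T\in\mathcal U(a,b)}\langle T,C\rangle+\sum_{j=1}^n\Omega(t_j)$$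 (which is $+\infty$ if $\mathcal U(a,b)=\emptyset$), $$D_\Omega(a,b,C)=\sup_{\alpha\in\mathbb{R}^m,\beta\in\mathbb{R}^n}\langle\alpha,a\rangle+\langle\beta,b\rangle-\sum_{j=1}^n\Omega_+^*(\alpha+\beta_j\mathbf 1_m-c_j),$$ $$S_\Omega(a,b,C)=\sup_{\alpha\in\mathbb{R}^m}\langle\alpha,a\rangle-P_\Omega^*(\alpha,b,C),$$ where $P_\Omega^*(\cdot,b,C)$ is the conjugate of $a\mapsto P_\Omega(a,b,C)$. Write $P_0, S_0$ for the case $\Omega=0$. Now let $\Omega(t)=\frac{\gamma}{2}\|t\|_2^2+\delta_{\mathcal B_1}(t)$, where $\mathcal B_1$ is the set of vectors of $\mathbb{R}^m$ with at most one nonzero entry. Then for all $s\in\mathbb{R}^m$ and all real $b\ge 0$ $$\Omega_+^*(s)=\frac{1}{2\gamma}\max_{i\in[m]}[s_i]_+^2,\qquad \Omega_b^*(s)=b\max_{i\in[m]}s_i-\frac{\gamma}{2}b^2,$$ and the suprema defining these conjugates are attained. Moreover, for all $a\in\triangle^m$, $b\in\triangle^n$ and $C\in\mathbb{R}^{m\times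 n}_+$, $$D_\Omega(a,b,C)=S_\Omega(a,b,C)=S_0(a,b,C)+\frac{\gamma}{2}\|b\|_2^2=P_0(a,b,C)+\frac{\gamma}{2}\|b\|_2^2,$$ the optimal values defining $D_\Omega$, $S_\Omega$, $S_0$ and $P_0$ are attained, and for every $\alpha\in\mathbb{R}^m$ one has $P_\Omega^*(\alpha,b,C)=\sum_{j}\Omega_{b_j}^*(\alpha-c_j)$ and $P_0^*(\alpha,b,C)=\sum_{j}0_{b_j}^*(\alpha-c_j)$, where $0_{b_j}^*=(\delta_{b_j\triangle^m})^*$, so that $S_\Omega$ and $S_0$ are equally the maxima of $\langle\alpha,a\rangle$ minus these sums. -/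

import Mathlib

namespace SparseOT

noncomputable section

variable {m n : ℕ}

/-- The effective domain of an extended-real-valued function. -/
def effDom (f : (Fin m → ℝ) → EReal) : Set (Fin m → ℝ) := {t | f t < ⊤}

open Classical in
/-- The indicator function of a set: `0` on the set, `+∞` off it. -/
def indicatorFn (K : Set (Fin m → ℝ)) : (Fin m → ℝ) → EReal :=
  fun t => if t ∈ K then 0 else ⊤

/-- The values `⟨s, t⟩ - f t`, for `t` in the effective domain of `f`. -/
def conjugateValues (f : (Fin m → ℝ) → EReal) (s : Fin m → ℝ) : Set EReal :=
  (fun t => ((s ⬝ᵥ t : ℝ) : EReal) - f t) '' effDom f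

/-- The convex conjugate `f^*(s) = sup_{t ∈ dom f} ⟨s, t⟩ - f t`. -/
def conjugate (f : (Fin m → ℝ) → EReal) (s : Fin m → ℝ) : EReal :=
  sSup (conjugateValues f s)

/-- The non-negative orthant. -/
def orthant (m : ℕ) : Set (Fin m → ℝ) := {t | ∀ i, 0 ≤ t i}

/-- The scaled simplex `b △^m`: non-negative vectors with sum `b`. -/
def scaledSimplex (m : ℕ) (b : ℝ) : Set (Fin m → ℝ) := {t | (∀ i, 0 ≤ t i) ∧ ∑ i, t i = b}

/-- The level set `B_k` of the `ℓ₀` pseudo-norm: vectors with at most `k` nonzero entries. -/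
def l0Ball (m k : ℕ) : Set (Fin m → ℝ) := {t | hammingNorm t ≤ k}

/-- `Ω = (γ/2) ‖·‖₂² + δ_{B_k}`. -/
def sparseQuad (m : ℕ) (γ : ℝ) (k : ℕ) : (Fin m → ℝ) → EReal :=
  fun t => ((γ / 2 * ∑ i, t i ^ 2 : ℝ) : EReal) + indicatorFn (l0Ball m k) t

/-- `Ω_+ = Ω + δ_{ℝ_+^m}`. -/
def restrictOrthant (Ω : (Fin m → ℝ) → EReal) : (Fin m → ℝ) → EReal :=
  fun t => Ω t + indicatorFn (orthant m) t

/-- `Ω_b = Ω + δ_{b △^m}`. -/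
def restrictSimplex (Ω : (Fin m → ℝ) → EReal) (b : ℝ) : (Fin m → ℝ) → EReal :=
  fun t => Ω t + indicatorFn (scaledSimplex m b) t

/-- The transportation polytope `U(a, b)`. -/
def transportPolytope (a : Fin m → ℝ) (b : Fin n → ℝ) : Set (Matrix (Fin m) (Fin n) ℝ) :=
  {T | (∀ i j, 0 ≤ T i j) ∧ (∀ i, ∑ j, T i j = a i) ∧ (∀ j, ∑ i, T i j = b j)}

/-- The values `⟨T, C⟩ + ∑ⱼ Ω(tⱼ)` of the primal objective on `U(a, b)`, where `tⱼ` is the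
`j`-th column of `T`. -/
def primalValues (Ω : (Fin m → ℝ) → EReal) (a : Fin m → ℝ) (b : Fin n → ℝ)
    (C : Matrix (Fin m) (Fin n) ℝ) : Set EReal :=
  (fun T : Matrix (Fin m) (Fin n) ℝ =>
    ((∑ i, ∑ j, T i j * C i j : ℝ) : EReal) + ∑ j, Ω (fun i => T i j)) '' transportPolytope a b

/-- The primal value `P_Ω(a, b, C)`; it is `+∞` when `U(a, b)` is empty. -/
def primal (Ω : (Fin m → ℝ) → EReal) (a : Fin m → ℝ) (b : Fin n → ℝ)
    (C : Matrix (Fin m) (Fin n) ℝ) : EReal :=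
  sInf (primalValues Ω a b C)

/-- The values `⟨α, a⟩ + ⟨β, b⟩ - ∑ⱼ Ω_+^*(α + βⱼ 1 - cⱼ)` of the dual objective. -/
def dualValues (Ω : (Fin m → ℝ) → EReal) (a : Fin m → ℝ) (b : Fin n → ℝ)
    (C : Matrix (Fin m) (Fin n) ℝ) : Set EReal :=
  Set.range fun p : (Fin m → ℝ) × (Fin n → ℝ) =>
    ((p.1 ⬝ᵥ a + p.2 ⬝ᵥ b : ℝ) : EReal)
      - ∑ j, conjugate (restrictOrthant Ω) (fun i => p.1 i + p.2 j - C i j)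

/-- The dual value `D_Ω(a, b, C)`. -/
def dual (Ω : (Fin m → ℝ) → EReal) (a : Fin m → ℝ) (b : Fin n → ℝ)
    (C : Matrix (Fin m) (Fin n) ℝ) : EReal :=
  sSup (dualValues Ω a b C)

/-- `P_Ω^*(α, b, C)`, the conjugate of `a ↦ P_Ω(a, b, C)`. -/
def primalConj (Ω : (Fin m → ℝ) → EReal) (α : Fin m → ℝ) (b : Fin n → ℝ)
    (C : Matrix (Fin m) (Fin n) ℝ) : EReal :=
  conjugate (fun a => primal Ω a b C) α

/-- The values `⟨α, a⟩ - P_Ω^*(α, b, C)` of the semi-dual objective. -/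
def semiDualValues (Ω : (Fin m → ℝ) → EReal) (a : Fin m → ℝ) (b : Fin n → ℝ)
    (C : Matrix (Fin m) (Fin n) ℝ) : Set EReal :=
  Set.range fun α : Fin m → ℝ => ((α ⬝ᵥ a : ℝ) : EReal) - primalConj Ω α b C

/-- The semi-dual value `S_Ω(a, b, C)`. -/
def semiDual (Ω : (Fin m → ℝ) → EReal) (a : Fin m → ℝ) (b : Fin n → ℝ)
    (C : Matrix (Fin m) (Fin n) ℝ) : EReal :=
  sSup (semiDualValues Ω a b C)

end

end SparseOT

open SparseOT

/-! A nonnegative vector with at most one nonzero entry is `x eᵢ` with `x ≥ 0`, so both conjugates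
are maxima over `i` of a one-variable problem. With `x` free, completing the square gives `[sᵢ]₊² /
(2γ)`; with mass `b` prescribed, `x = b` and the quadratic term is the constant `γ b² / 2`. Hence
the semi-dual objective is that of unregularized transport, `F(α) = ⟨α, a⟩ - ∑ⱼ bⱼ maxᵢ (αᵢ - Cᵢⱼ)`,
plus `γ/2 ‖b‖²`. In the dual, maximizing over each `βⱼ` separately leaves the same function of `α`.

What remains is strong duality with attainment for `Ω = 0`. A maximizer of `F` exists by reduction
to a compact cube (`exists_isMax_semiDualObjective`). At a maximizer, `a` is the vector of row sums
of a plan charging active pairs only, since otherwise a separating hyperplane is an ascent direction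
(`exists_activePlan_of_isMax`). Complementary slackness makes the cost of that plan equal to `F(α)`.
-/

namespace SparseOT

open Filter Topology

variable {m n : ℕ}

/-! ### Conjugates certified by touching affine minorants -/

section Conjugate

lemma indicatorFn_of_mem {K : Set (Fin m → ℝ)} {t : Fin m → ℝ} (ht : t ∈ K) :
    indicatorFn K t = 0 := if_pos ht

lemma indicatorFn_of_notMem {K : Set (Fin m → ℝ)} {t : Fin m → ℝ} (ht : t ∉ K) :
    indicatorFn K t = ⊤ := if_neg ht

lemma indicatorFn_nonneg (K : Set (Fin m → ℝ)) (t : Fin m → ℝ) : 0 ≤ indicatorFn K t := by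
  by_cases ht : t ∈ K
  · rw [indicatorFn_of_mem ht]
  · rw [indicatorFn_of_notMem ht]; exact le_top

lemma coe_sum {ι : Type*} (s : Finset ι) (f : ι → ℝ) :
    ((∑ i ∈ s, f i : ℝ) : EReal) = ∑ i ∈ s, (f i : EReal) := by
  classical
  induction s using Finset.induction_on with
  | empty => simp
  | insert i s hi ih => rw [Finset.sum_insert hi, Finset.sum_insert hi, EReal.coe_add, ih]

/-- If the affine function `⟨s, ·⟩ - v` minorizes `f` and touches it at some point, then `v` is the
maximum defining `f^*(s)`. -/
lemma isGreatest_conjugateValues {f : (Fin m → ℝ) → EReal} {s : Fin m → ℝ} {v : ℝ}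
    (hle : ∀ t, ((s ⬝ᵥ t - v : ℝ) : EReal) ≤ f t)
    (heq : ∃ t, f t = ((s ⬝ᵥ t - v : ℝ) : EReal)) :
    IsGreatest (conjugateValues f s) (v : EReal) := by
  constructor
  · obtain ⟨t, ht⟩ := heq
    refine ⟨t, ?_, ?_⟩
    · change f t < ⊤
      rw [ht]; exact EReal.coe_lt_top _
    · change _ - f t = _
      rw [ht, ← EReal.coe_sub]
      congr 1; ring
  · rintro _ ⟨t, -, rfl⟩
    change _ - f t ≤ _
    refine (EReal.sub_le_sub le_rfl (hle t)).trans ?_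
    rw [← EReal.coe_sub, EReal.coe_le_coe_iff]
    linarith

lemma conjugate_eq {f : (Fin m → ℝ) → EReal} {s : Fin m → ℝ} {v : EReal}
    (h : IsGreatest (conjugateValues f s) v) : conjugate f s = v :=
  h.isLUB.sSup_eq

/-- The maximum defining `(f + δ_K)^*(s)`. -/
lemma isGreatest_conjugateValues_add_indicatorFn {f : (Fin m → ℝ) → EReal}
    {K : Set (Fin m → ℝ)} {s : Fin m → ℝ} {v : ℝ} (hf : ∀ t, 0 ≤ f t)
    (hle : ∀ t ∈ K, ((s ⬝ᵥ t - v : ℝ) : EReal) ≤ f t)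
    (heq : ∃ t ∈ K, f t = ((s ⬝ᵥ t - v : ℝ) : EReal)) :
    IsGreatest (conjugateValues (fun t => f t + indicatorFn K t) s) (v : EReal) := by
  refine isGreatest_conjugateValues (fun t => ?_) ?_
  · by_cases ht : t ∈ K
    · simpa [indicatorFn_of_mem ht] using hle t ht
    · rw [indicatorFn_of_notMem ht, EReal.add_top_of_ne_bot]
      · exact le_top
      · exact ne_bot_of_le_ne_bot EReal.zero_ne_bot (hf t)
  · obtain ⟨t, ht, h⟩ := heq
    exact ⟨t, by simpa [indicatorFn_of_mem ht] using h⟩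

/-- Weak duality and complementary slackness both rest on this rearrangement: each column
contributes its own Fenchel–Young gap to the transport cost. -/
lemma dotProduct_rowSum_sub (α : Fin m → ℝ) (C T : Matrix (Fin m) (Fin n) ℝ) (v : Fin n → ℝ) :
    (α ⬝ᵥ fun i => ∑ j, T i j) - ∑ j, v j
      = ∑ i, ∑ j, T i j * C i j
        + ∑ j, ((fun i => α i - C i j) ⬝ᵥ (fun i => T i j) - v j) := by
  have h : ∑ j, (fun i => α i - C i j) ⬝ᵥ (fun i => T i j)
      = (α ⬝ᵥ fun i => ∑ j, T i j) - ∑ i, ∑ j, T i j * C i j := by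
    simp only [dotProduct, sub_mul, Finset.sum_sub_distrib, Finset.mul_sum]
    congr 1
    · exact Finset.sum_comm
    · rw [Finset.sum_comm]
      simp only [mul_comm]
  rw [Finset.sum_sub_distrib, h]
  ring

end Conjugate

/-! ### The maximum entry of a vector -/

section MaxEntry

/-- The largest entry of a vector. -/
noncomputable def maxEntry [NeZero m] (s : Fin m → ℝ) : ℝ :=
  Finset.univ.sup' Finset.univ_nonempty s

variable [NeZero m]

lemma le_maxEntry (s : Fin m → ℝ) (i : Fin m) : s i ≤ maxEntry s :=
  Finset.le_sup' s (Finset.mem_univ i)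

lemma exists_eq_maxEntry (s : Fin m → ℝ) : ∃ i, s i = maxEntry s := by
  obtain ⟨i, -, hi⟩ := Finset.exists_mem_eq_sup' Finset.univ_nonempty s
  exact ⟨i, hi.symm⟩

lemma maxEntry_le {s : Fin m → ℝ} {x : ℝ} (h : ∀ i, s i ≤ x) : maxEntry s ≤ x :=
  Finset.sup'_le _ _ fun i _ => h i

lemma maxEntry_add_const (s : Fin m → ℝ) (x : ℝ) :
    maxEntry (fun i => s i + x) = maxEntry s + x := by
  apply le_antisymm
  · exact maxEntry_le fun i => by linarith [le_maxEntry s i]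
  · obtain ⟨i, hi⟩ := exists_eq_maxEntry s
    rw [← hi]
    exact le_maxEntry (fun i => s i + x) i

lemma maxEntry_sq_max (s : Fin m → ℝ) :
    maxEntry (fun i => max (s i) 0 ^ 2) = max (maxEntry s) 0 ^ 2 := by
  apply le_antisymm
  · refine maxEntry_le fun i => ?_
    have := le_maxEntry s i
    gcongr
  · obtain ⟨i, hi⟩ := exists_eq_maxEntry s
    rw [← hi]
    exact le_maxEntry (fun i => max (s i) 0 ^ 2) i

lemma dotProduct_le_mul_maxEntry {b : ℝ} {t : Fin m → ℝ} (ht : t ∈ scaledSimplex m b)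
    (s : Fin m → ℝ) : s ⬝ᵥ t ≤ b * maxEntry s := by
  rw [← ht.2, Finset.sum_mul]
  refine Finset.sum_le_sum fun i _ => ?_
  rw [mul_comm]
  exact mul_le_mul_of_nonneg_left (le_maxEntry s i) (ht.1 i)

lemma continuous_maxEntry : Continuous (maxEntry : (Fin m → ℝ) → ℝ) :=
  Continuous.finset_sup'_apply _ fun i _ => continuous_apply i

end MaxEntry

/-! ### The 1-sparse quadratic and its conjugate on the orthant -/

section SparseQuad

lemma single_mem_scaledSimplex {b : ℝ} (hb : 0 ≤ b) (i : Fin m) :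
    Pi.single i b ∈ scaledSimplex m b := by
  refine ⟨fun k => ?_, by simp⟩
  rcases eq_or_ne k i with rfl | h <;> simp [*]

lemma single_mem_l0Ball (i : Fin m) (x : ℝ) : Pi.single i x ∈ l0Ball m 1 := by
  change Finset.card _ ≤ 1
  refine Finset.card_le_one.2 fun k hk l hl => ?_
  have aux : ∀ k, Pi.single (M := fun _ => ℝ) i x k ≠ 0 → k = i := fun k hk => by
    by_contra h
    exact hk (by rw [Pi.single_eq_of_ne h])
  rw [aux k (Finset.mem_filter.1 hk).2, aux l (Finset.mem_filter.1 hl).2]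

lemma exists_eq_single_of_mem_l0Ball [NeZero m] {t : Fin m → ℝ} (ht : t ∈ l0Ball m 1) :
    ∃ i, t = Pi.single i (t i) := by
  replace ht : Finset.card _ ≤ 1 := ht
  rw [Finset.card_le_one] at ht
  by_cases h : ∃ i, t i ≠ 0
  · obtain ⟨i, hi⟩ := h
    refine ⟨i, funext fun k => ?_⟩
    rcases eq_or_ne k i with rfl | hki
    · simp
    · rw [Pi.single_eq_of_ne hki]
      by_contra hk
      exact hki (ht k (by simpa using hk) i (by simpa using hi))
  · push Not at h
    exact ⟨0, funext fun k => by simp [h]⟩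

lemma sparseQuad_single (γ : ℝ) (i : Fin m) (x : ℝ) :
    sparseQuad m γ 1 (Pi.single i x) = ((γ / 2 * x ^ 2 : ℝ) : EReal) := by
  have h : ∑ k, (Pi.single i x : Fin m → ℝ) k ^ 2 = x ^ 2 := by
    rw [Finset.sum_eq_single i] <;> simp +contextual
  rw [sparseQuad, indicatorFn_of_mem (single_mem_l0Ball i x), h, add_zero]

lemma sparseQuad_nonneg {γ : ℝ} (hγ : 0 < γ) (k : ℕ) (t : Fin m → ℝ) :
    0 ≤ sparseQuad m γ k t := by
  refine add_nonneg ?_ (indicatorFn_nonneg _ _)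
  rw [← EReal.coe_zero, EReal.coe_le_coe_iff]
  exact mul_nonneg (by positivity) (Finset.sum_nonneg fun i _ => sq_nonneg _)

lemma sparseQuad_of_notMem (γ : ℝ) {k : ℕ} {t : Fin m → ℝ} (ht : t ∉ l0Ball m k) :
    sparseQuad m γ k t = ⊤ := by
  rw [sparseQuad, indicatorFn_of_notMem ht, EReal.coe_add_top]

variable [NeZero m]

/-- To bound `sparseQuad m γ 1` below on `K` it suffices to consider vectors with one nonzero
entry. -/
lemma coe_le_sparseQuad {γ v : ℝ} {K : Set (Fin m → ℝ)} {s : Fin m → ℝ}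
    (h : ∀ i x, Pi.single i x ∈ K → s i * x - v ≤ γ / 2 * x ^ 2) {t : Fin m → ℝ} (ht : t ∈ K) :
    ((s ⬝ᵥ t - v : ℝ) : EReal) ≤ sparseQuad m γ 1 t := by
  by_cases ht1 : t ∈ l0Ball m 1
  · obtain ⟨i, hi⟩ := exists_eq_single_of_mem_l0Ball ht1
    rw [hi] at ht ⊢
    rw [sparseQuad_single, dotProduct_single, EReal.coe_le_coe_iff]
    exact h i _ ht
  · rw [sparseQuad_of_notMem γ ht1]; exact le_top

lemma isGreatest_conjugate_restrictOrthant_sparseQuad {γ : ℝ} (hγ : 0 < γ) (s : Fin m → ℝ) :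
    IsGreatest (conjugateValues (restrictOrthant (sparseQuad m γ 1)) s)
      ((1 / (2 * γ) * max (maxEntry s) 0 ^ 2 : ℝ) : EReal) := by
  refine isGreatest_conjugateValues_add_indicatorFn (sparseQuad_nonneg hγ 1)
    (fun t ht => coe_le_sparseQuad (fun i x hx => ?_) ht) ?_
  · replace hx : 0 ≤ x := by simpa using hx i
    have h1 : s i * x ≤ max (maxEntry s) 0 * x :=
      mul_le_mul_of_nonneg_right ((le_maxEntry s i).trans (le_max_left _ _)) hx
    have h2 : 0 ≤ 1 / (2 * γ) * (γ * x - max (maxEntry s) 0) ^ 2 := by positivity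
    have h3 : 1 / (2 * γ) * (γ * x - max (maxEntry s) 0) ^ 2
        = γ / 2 * x ^ 2 - max (maxEntry s) 0 * x + 1 / (2 * γ) * max (maxEntry s) 0 ^ 2 := by
      field_simp; ring
    linarith
  · obtain ⟨i, hi⟩ := exists_eq_maxEntry s
    have hx : 0 ≤ max (maxEntry s) 0 / γ := div_nonneg (le_max_right _ _) hγ.le
    -- The amplitude maximizes `x ↦ sᵢ x - γ/2 x²` over `x ≥ 0`, at an index `i` where `s` is
    -- largest.
    refine ⟨Pi.single i (max (maxEntry s) 0 / γ), (single_mem_scaledSimplex hx i).1, ?_⟩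
    rw [sparseQuad_single, dotProduct_single, hi]
    congr 1
    have : maxEntry s * max (maxEntry s) 0 = max (maxEntry s) 0 ^ 2 := by
      rcases le_total (maxEntry s) 0 with h | h
      · simp [max_eq_right h]
      · rw [max_eq_left h, sq]
    rw [mul_div_assoc', this]
    field_simp; ring

end SparseQuad

/-! ### Conjugates on scaled simplices and the conjugate of the primal value -/

section Simplex

variable [NeZero m]

/-- `Ω` is non-negative, and for every `s` the affine function `⟨s, ·⟩ - v` with
`v = b max s - q b` minorizes it on `b △^m` and touches it there. -/
structure IsVertexExact (Ω : (Fin m → ℝ) → EReal) (q : ℝ → ℝ) : Prop where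
  nonneg : ∀ t, 0 ≤ Ω t
  le : ∀ b, 0 ≤ b → ∀ s, ∀ t ∈ scaledSimplex m b,
    ((s ⬝ᵥ t - (b * maxEntry s - q b) : ℝ) : EReal) ≤ Ω t
  eq : ∀ b, 0 ≤ b → ∀ s, ∃ t ∈ scaledSimplex m b,
    Ω t = ((s ⬝ᵥ t - (b * maxEntry s - q b) : ℝ) : EReal)

lemma isVertexExact_zero : IsVertexExact (0 : (Fin m → ℝ) → EReal) fun _ => 0 where
  nonneg _ := le_rfl
  le b _ s t ht := by
    rw [Pi.zero_apply, ← EReal.coe_zero, EReal.coe_le_coe_iff]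
    linarith [dotProduct_le_mul_maxEntry ht s]
  eq b hb s := by
    obtain ⟨i, hi⟩ := exists_eq_maxEntry s
    refine ⟨_, single_mem_scaledSimplex hb i, ?_⟩
    rw [Pi.zero_apply, ← EReal.coe_zero, dotProduct_single, hi]
    congr 1; ring

lemma isVertexExact_sparseQuad {γ : ℝ} (hγ : 0 < γ) :
    IsVertexExact (sparseQuad m γ 1) fun b => γ / 2 * b ^ 2 where
  nonneg := sparseQuad_nonneg hγ 1
  le b _ s t ht := by
    refine coe_le_sparseQuad (fun i x hx => ?_) ht
    have hxb : x = b := by simpa using hx.2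
    have := dotProduct_le_mul_maxEntry hx s
    rw [dotProduct_single] at this
    subst hxb
    linarith
  eq b hb s := by
    obtain ⟨i, hi⟩ := exists_eq_maxEntry s
    refine ⟨_, single_mem_scaledSimplex hb i, ?_⟩
    rw [sparseQuad_single, dotProduct_single, hi]
    congr 1; ring

variable {Ω : (Fin m → ℝ) → EReal} {q : ℝ → ℝ}

lemma IsVertexExact.isGreatest_conjugate_restrictSimplex (h : IsVertexExact Ω q) {b : ℝ}
    (hb : 0 ≤ b) (s : Fin m → ℝ) :
    IsGreatest (conjugateValues (restrictSimplex Ω b) s)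
      ((b * maxEntry s - q b : ℝ) : EReal) :=
  isGreatest_conjugateValues_add_indicatorFn h.nonneg (h.le b hb s) (h.eq b hb s)

/-- Weak duality: the Fenchel–Young inequality is applied to each column and summed. -/
lemma IsVertexExact.coe_le_primal (h : IsVertexExact Ω q) (a : Fin m → ℝ) {b : Fin n → ℝ}
    (hb : ∀ j, 0 ≤ b j) (C : Matrix (Fin m) (Fin n) ℝ) (α : Fin m → ℝ) :
    ((α ⬝ᵥ a - ∑ j, (b j * maxEntry (fun i => α i - C i j) - q (b j)) : ℝ) : EReal)
      ≤ primal Ω a b C := by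
  refine le_sInf ?_
  rintro _ ⟨T, ⟨hT0, hTa, hTb⟩, rfl⟩
  have ha : a = fun i => ∑ j, T i j := funext fun i => (hTa i).symm
  rw [ha, dotProduct_rowSum_sub α C T, EReal.coe_add, coe_sum (Finset.univ : Finset (Fin n))]
  exact add_le_add le_rfl (Finset.sum_le_sum fun j _ =>
    h.le _ (hb j) _ _ ⟨fun i => hT0 i j, hTb j⟩)

/-- The conjugate of `a ↦ P_Ω(a, b, C)` splits over the columns. -/
lemma IsVertexExact.primalConj_eq (h : IsVertexExact Ω q) {b : Fin n → ℝ}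
    (hb : ∀ j, 0 ≤ b j) (C : Matrix (Fin m) (Fin n) ℝ) (α : Fin m → ℝ) :
    primalConj Ω α b C
      = ((∑ j, (b j * maxEntry (fun i => α i - C i j) - q (b j)) : ℝ) : EReal) := by
  refine conjugate_eq (isGreatest_conjugateValues (fun a => h.coe_le_primal a hb C α) ?_)
  choose t ht using fun j => h.eq (b j) (hb j) (fun i => α i - C i j)
  -- The conjugate leaves the row marginal free, so the columns can be chosen tight independently
  -- and `a` read off as their row sums.
  refine ⟨fun i => ∑ j, t j i, le_antisymm (sInf_le ?_) (h.coe_le_primal _ hb C α)⟩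
  refine ⟨fun i j => t j i, ⟨fun i j => (ht j).1.1 i, fun i => rfl, fun j => (ht j).1.2⟩, ?_⟩
  rw [dotProduct_rowSum_sub α C (fun i j => t j i), EReal.coe_add, coe_sum (Finset.univ : Finset (Fin n))]
  exact congrArg (((_ : ℝ) : EReal) + ·) (Finset.sum_congr rfl fun j _ => (ht j).2)

end Simplex

end SparseOT

namespace SparseOT

open Filter Topology

variable {m n : ℕ} [NeZero m]

/-! ### Strong duality for unregularized transport -/

section Duality

/-- The semi-dual objective `⟨α, a⟩ - ∑ⱼ bⱼ maxᵢ (αᵢ - Cᵢⱼ)` of unregularized transport. -/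
noncomputable def semiDualObjective (a : Fin m → ℝ) (b : Fin n → ℝ)
    (C : Matrix (Fin m) (Fin n) ℝ) (α : Fin m → ℝ) : ℝ :=
  α ⬝ᵥ a - ∑ j, b j * maxEntry (fun i => α i - C i j)

lemma continuous_semiDualObjective (a : Fin m → ℝ) (b : Fin n → ℝ)
    (C : Matrix (Fin m) (Fin n) ℝ) : Continuous (semiDualObjective a b C) := by
  unfold semiDualObjective
  refine Continuous.sub ?_ (continuous_finsetSum _ fun j _ => continuous_const.mul ?_)
  · unfold dotProduct; fun_prop
  · exact continuous_maxEntry.comp (by fun_prop)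

/-- Adding a constant to the potential does not change the objective when the masses agree. -/
lemma semiDualObjective_add_const {a : Fin m → ℝ} {b : Fin n → ℝ}
    (hab : ∑ i, a i = ∑ j, b j) (C : Matrix (Fin m) (Fin n) ℝ) (α : Fin m → ℝ) (x : ℝ) :
    semiDualObjective a b C (fun i => α i + x) = semiDualObjective a b C α := by
  have h : ∀ j, maxEntry (fun i => α i + x - C i j) = maxEntry (fun i => α i - C i j) + x := by
    intro j
    rw [← maxEntry_add_const]
    congr 1; ext i; ring
  simp only [semiDualObjective, h, dotProduct, add_mul, mul_add, Finset.sum_add_distrib,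
    ← Finset.sum_mul, ← Finset.mul_sum, hab]
  ring

/-- Raising the entries of the potential that are too small to matter improves the objective. -/
lemma semiDualObjective_le_clamp {a : Fin m → ℝ} {b : Fin n → ℝ} {C : Matrix (Fin m) (Fin n) ℝ}
    (ha : ∀ i, 0 ≤ a i) (hb : ∀ j, 0 ≤ b j) (hC : ∀ i j, 0 ≤ C i j) {K : ℝ}
    (hK : ∀ i j, C i j ≤ K) (α : Fin m → ℝ) :
    semiDualObjective a b C α ≤
      semiDualObjective a b C (fun i => max (α i) (maxEntry α - K)) := by
  obtain ⟨k, hk⟩ := exists_eq_maxEntry α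
  refine sub_le_sub (Finset.sum_le_sum fun i _ => ?_) (Finset.sum_le_sum fun j _ => ?_)
  · exact mul_le_mul_of_nonneg_right (le_max_left _ _) (ha i)
  · refine mul_le_mul_of_nonneg_left (maxEntry_le fun i => ?_) (hb j)
    rw [sub_le_iff_le_add]
    refine max_le ?_ ?_
    · linarith [le_maxEntry (fun i => α i - C i j) i]
    -- A raised entry cannot increase a column maximum: `max α - K - Cᵢⱼ ≤ αₖ - Cₖⱼ`, with `k` a
    -- largest entry of `α`.
    · linarith [le_maxEntry (fun i => α i - C i j) k, hC i j, hK k j]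

/-- Clamping and then shifting by `-max α` moves any potential into the cube `[-K, 0]^m` without
lowering the objective, so a maximum over this compact set is global. -/
lemma exists_isMax_semiDualObjective {a : Fin m → ℝ} {b : Fin n → ℝ}
    {C : Matrix (Fin m) (Fin n) ℝ} (ha : ∀ i, 0 ≤ a i) (hb : ∀ j, 0 ≤ b j)
    (hab : ∑ i, a i = ∑ j, b j) (hC : ∀ i j, 0 ≤ C i j) :
    ∃ α, ∀ α', semiDualObjective a b C α' ≤ semiDualObjective a b C α := by
  obtain ⟨K, hK0, hK⟩ : ∃ K : ℝ, 0 ≤ K ∧ ∀ i j, C i j ≤ K := by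
    refine ⟨∑ i, ∑ j, C i j, Finset.sum_nonneg fun i _ => Finset.sum_nonneg fun j _ => hC i j,
      fun i j => ?_⟩
    exact (Finset.single_le_sum (f := fun j => C i j) (fun j _ => hC i j)
      (Finset.mem_univ j)).trans (Finset.single_le_sum (f := fun i => ∑ j, C i j)
        (fun i _ => Finset.sum_nonneg fun j _ => hC i j) (Finset.mem_univ i))
  obtain ⟨α, -, hα⟩ := (isCompact_Icc (a := fun _ : Fin m => -K) (b := fun _ => 0)).exists_isMaxOn
    (Set.nonempty_Icc.2 fun _ => by simpa using hK0)
    (continuous_semiDualObjective a b C).continuousOn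
  refine ⟨α, fun α' => ?_⟩
  refine (semiDualObjective_le_clamp ha hb hC hK α').trans ?_
  rw [← semiDualObjective_add_const hab C _ (-maxEntry α')]
  refine hα ⟨fun i => ?_, fun i => ?_⟩
  · change -K ≤ _ + _
    linarith [le_max_right (α' i) (maxEntry α' - K)]
  · change _ + _ ≤ (0 : ℝ)
    linarith [max_le (le_maxEntry α' i) (by linarith : maxEntry α' - K ≤ maxEntry α')]

/-- The plans with column sums `b` that charge only pairs `(i, j)` at which `αᵢ - Cᵢⱼ` is maximal
in its column. -/
def activePlans (b : Fin n → ℝ) (C : Matrix (Fin m) (Fin n) ℝ) (α : Fin m → ℝ) :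
    Set (Fin m → Fin n → ℝ) :=
  {T | (∀ i j, 0 ≤ T i j) ∧ (∀ j, ∑ i, T i j = b j) ∧
    ∀ i j, α i - C i j ≠ maxEntry (fun k => α k - C k j) → T i j = 0}

lemma isCompact_activePlans (b : Fin n → ℝ) (C : Matrix (Fin m) (Fin n) ℝ) (α : Fin m → ℝ) :
    IsCompact (activePlans b C α) := by
  refine (isCompact_Icc (a := fun _ _ => 0) (b := fun _ j => b j)).of_isClosed_subset ?_ ?_
  · simp only [activePlans, Set.ofPred_and, Set.ofPred_forall]
    refine (isClosed_iInter fun i => isClosed_iInter fun j =>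
      isClosed_le (by fun_prop) (by fun_prop)).inter ((isClosed_iInter fun j =>
      isClosed_eq (by fun_prop) (by fun_prop)).inter (isClosed_iInter fun i =>
      isClosed_iInter fun j => isClosed_iInter fun _ => isClosed_eq (by fun_prop) (by fun_prop)))
  · rintro T ⟨hT0, hTb, -⟩
    refine ⟨fun i j => hT0 i j, fun i j => ?_⟩
    change T i j ≤ b j
    rw [← hTb j]
    exact Finset.single_le_sum (f := fun i => T i j) (fun i _ => hT0 i j) (Finset.mem_univ i)

lemma convex_activePlans (b : Fin n → ℝ) (C : Matrix (Fin m) (Fin n) ℝ) (α : Fin m → ℝ) :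
    Convex ℝ (activePlans b C α) := by
  rintro T ⟨hT0, hTb, hTs⟩ T' ⟨hT0', hTb', hTs'⟩ x y hx hy hxy
  refine ⟨fun i j => ?_, fun j => ?_, fun i j h => ?_⟩
  · exact add_nonneg (mul_nonneg hx (hT0 i j)) (mul_nonneg hy (hT0' i j))
  · simp only [Pi.add_apply, Pi.smul_apply, smul_eq_mul, Finset.sum_add_distrib,
      ← Finset.mul_sum, hTb, hTb', ← add_mul, hxy, one_mul]
  · simp [hTs i j h, hTs' i j h]

/-- The row sums of a plan, as a linear map. -/
def rowSums (m n : ℕ) : (Fin m → Fin n → ℝ) →ₗ[ℝ] (Fin m → ℝ) where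
  toFun T i := ∑ j, T i j
  map_add' T T' := by ext i; simp [Finset.sum_add_distrib]
  map_smul' x T := by ext i; simp [Finset.mul_sum]

/-- In a direction `d`, the column maxima of `α - C` grow initially at most at the rate `r j`
if `r j` bounds `d` on the entries attaining the maximum. -/
lemma exists_pos_maxEntry_le (C : Matrix (Fin m) (Fin n) ℝ) (α d : Fin m → ℝ) (r : Fin n → ℝ)
    (hr : ∀ i j, α i - C i j = maxEntry (fun k => α k - C k j) → d i ≤ r j) :
    ∃ ε > 0, ∀ j, maxEntry (fun i => α i + ε * d i - C i j)
      ≤ maxEntry (fun i => α i - C i j) + ε * r j := by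
  have h : ∀ i j, ∀ᶠ ε : ℝ in 𝓝[>] 0,
      α i + ε * d i - C i j ≤ maxEntry (fun i => α i - C i j) + ε * r j := by
    intro i j
    by_cases hij : α i - C i j = maxEntry (fun k => α k - C k j)
    · filter_upwards [self_mem_nhdsWithin] with ε hε
      have := mul_le_mul_of_nonneg_left (hr i j hij) (le_of_lt hε)
      linarith
    -- An inactive entry lies strictly below the maximum, and the gap survives for small `ε`.
    · have hlt := lt_of_le_of_ne (le_maxEntry (fun k => α k - C k j) i) hij
      have hl : ContinuousAt (fun ε : ℝ => α i + ε * d i - C i j) 0 := by fun_prop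
      have hr : ContinuousAt
          (fun ε : ℝ => maxEntry (fun i => α i - C i j) + ε * r j) 0 := by fun_prop
      have := hl.eventually_lt hr (by simpa using hlt)
      exact (this.filter_mono nhdsWithin_le_nhds).mono fun _ h => h.le
  obtain ⟨ε, hε, hpos⟩ :=
    ((eventually_all.2 fun j => eventually_all.2 fun i => h i j).and self_mem_nhdsWithin).exists
  exact ⟨ε, hpos, fun j => maxEntry_le fun i => hε j i⟩

/-- At a maximizer of the semi-dual objective there is a plan with marginals `a` and `b` that
charges active pairs only. -/
lemma exists_activePlan_of_isMax {a : Fin m → ℝ} {b : Fin n → ℝ} {C : Matrix (Fin m) (Fin n) ℝ}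
    {α : Fin m → ℝ} (hb : ∀ j, 0 ≤ b j)
    (hα : ∀ α', semiDualObjective a b C α' ≤ semiDualObjective a b C α) :
    ∃ T ∈ activePlans b C α, rowSums m n T = a := by
  by_contra! hne
  have ha : a ∉ rowSums m n '' activePlans b C α := by
    rintro ⟨T, hT, h⟩; exact hne T hT h
  obtain ⟨f, u, hf, hu⟩ := geometric_hahn_banach_closed_point
    ((convex_activePlans b C α).linear_image (rowSums m n))
    ((isCompact_activePlans b C α).image
      (rowSums m n).continuous_of_finiteDimensional).isClosed ha
  set d : Fin m → ℝ := fun i => f (Pi.single i 1)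
  have hfd : ∀ x, f x = d ⬝ᵥ x := fun x => by
    conv_lhs => rw [← Finset.univ_sum_single x]
    rw [map_sum]
    refine Finset.sum_congr rfl fun i _ => ?_
    rw [mul_comm, ← smul_eq_mul, ← map_smul, ← Pi.single_smul, smul_eq_mul, mul_one]
  have hsel : ∀ j, ∃ k, α k - C k j = maxEntry (fun i => α i - C i j) ∧
      ∀ i, α i - C i j = maxEntry (fun i => α i - C i j) → d i ≤ d k := by
    intro j
    obtain ⟨k, hk, hk'⟩ := Set.exists_max_image
      {i | α i - C i j = maxEntry (fun i => α i - C i j)} d (Set.toFinite _)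
      (exists_eq_maxEntry _)
    exact ⟨k, hk, hk'⟩
  choose k hk hkmax using hsel
  -- Putting each column's mass on an active entry with largest `d` gives the plan whose row sums
  -- come closest to the hyperplane; separation then reads `∑ⱼ bⱼ d (k j) < ⟨d, a⟩`.
  have hT : (fun i j => if i = k j then b j else 0) ∈ activePlans b C α := by
    refine ⟨fun i j => ?_, fun j => by simp, fun i j h => ?_⟩
    · dsimp only; split_ifs
      exacts [hb j, le_rfl]
    · refine if_neg ?_
      rintro rfl
      exact h (hk j)
  have h1 := (hf _ ⟨_, hT, rfl⟩).trans hu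
  have h2 : d ⬝ᵥ rowSums m n (fun i j => if i = k j then b j else 0) = ∑ j, b j * d (k j) := by
    simp only [rowSums, dotProduct, LinearMap.coe_mk, AddHom.coe_mk, Finset.mul_sum]
    rw [Finset.sum_comm]
    simp [mul_comm]
  rw [hfd, hfd, h2] at h1
  obtain ⟨ε, hε, hle⟩ := exists_pos_maxEntry_le C α d (fun j => d (k j)) fun i j => hkmax j i
  -- Along `d` the linear term gains `ε ⟨d, a⟩` while the maxima cost at most `ε ∑ⱼ bⱼ d (k j)`,
  -- contradicting maximality.
  have h3 := hα (fun i => α i + ε * d i)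
  have h4 : ∑ j, b j * maxEntry (fun i => α i + ε * d i - C i j)
      ≤ ∑ j, b j * maxEntry (fun i => α i - C i j) + ε * ∑ j, b j * d (k j) := by
    rw [Finset.mul_sum, ← Finset.sum_add_distrib]
    refine Finset.sum_le_sum fun j _ => ?_
    have := mul_le_mul_of_nonneg_left (hle j) (hb j)
    linarith
  have h5 : (fun i => α i + ε * d i) ⬝ᵥ a = α ⬝ᵥ a + ε * d ⬝ᵥ a := by
    simp only [dotProduct, add_mul, Finset.sum_add_distrib, Finset.mul_sum, mul_assoc]
  rw [semiDualObjective, semiDualObjective, h5] at h3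
  have := mul_lt_mul_of_pos_left h1 hε
  linarith

/-- Strong duality for optimal transport: a maximizer of the semi-dual objective and an optimal
plan of the same value exist. -/
lemma exists_isMax_isLeast_primalValues_zero {a : Fin m → ℝ} {b : Fin n → ℝ}
    {C : Matrix (Fin m) (Fin n) ℝ} (ha : ∀ i, 0 ≤ a i) (hb : ∀ j, 0 ≤ b j)
    (hab : ∑ i, a i = ∑ j, b j) (hC : ∀ i j, 0 ≤ C i j) :
    ∃ α, (∀ α', semiDualObjective a b C α' ≤ semiDualObjective a b C α) ∧
      IsLeast (primalValues 0 a b C) (semiDualObjective a b C α : EReal) := by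
  obtain ⟨α, hα⟩ := exists_isMax_semiDualObjective ha hb hab hC
  obtain ⟨T, ⟨hT0, hTb, hTs⟩, hTa⟩ := exists_activePlan_of_isMax hb hα
  refine ⟨α, hα, ⟨T, ⟨hT0, fun i => congrFun hTa i, hTb⟩, ?_⟩, ?_⟩
  · have h := dotProduct_rowSum_sub α C T (fun j => b j * maxEntry (fun i => α i - C i j))
    -- Complementary slackness: mass sits only where the column maximum is attained.
    have h0 : ∀ j, (fun i => α i - C i j) ⬝ᵥ (fun i => T i j)
        - b j * maxEntry (fun i => α i - C i j) = 0 := by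
      intro j
      rw [sub_eq_zero, ← hTb j, Finset.sum_mul]
      refine Finset.sum_congr rfl fun i _ => ?_
      change (α i - C i j) * T i j = T i j * _
      by_cases hij : α i - C i j = maxEntry (fun k => α k - C k j)
      · rw [hij, mul_comm]
      · rw [hTs i j hij, mul_zero, zero_mul]
    simp only [h0, Finset.sum_const_zero, add_zero] at h
    simp only [Pi.zero_apply, Finset.sum_const_zero, add_zero]
    rw [semiDualObjective, ← h, ← hTa]
    rfl
  · intro x hx
    have := isVertexExact_zero.coe_le_primal a hb C α
    simp only [sub_zero] at this
    exact this.trans (sInf_le hx)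

/-! ### Regularized semi-dual and dual values -/

variable {Ω : (Fin m → ℝ) → EReal} {q : ℝ → ℝ}

lemma IsVertexExact.isGreatest_semiDualValues (h : IsVertexExact Ω q) {a : Fin m → ℝ}
    {b : Fin n → ℝ} {C : Matrix (Fin m) (Fin n) ℝ} (hb : ∀ j, 0 ≤ b j) {α : Fin m → ℝ}
    (hα : ∀ α', semiDualObjective a b C α' ≤ semiDualObjective a b C α) :
    IsGreatest (semiDualValues Ω a b C)
      ((semiDualObjective a b C α + ∑ j, q (b j) : ℝ) : EReal) := by
  have key : ∀ α', ((α' ⬝ᵥ a : ℝ) : EReal) - primalConj Ω α' b C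
      = ((semiDualObjective a b C α' + ∑ j, q (b j) : ℝ) : EReal) := by
    intro α'
    rw [h.primalConj_eq hb, ← EReal.coe_sub, Finset.sum_sub_distrib, semiDualObjective]
    congr 1; ring
  refine ⟨⟨α, key α⟩, ?_⟩
  rintro _ ⟨α', rfl⟩
  refine (key α').trans_le ?_
  rw [EReal.coe_le_coe_iff]
  linarith [hα α']

/-- In the variables `xⱼ = maxᵢ (αᵢ - Cᵢⱼ) + βⱼ` the dual objective separates into `F(α)` and one
scalar concave problem per column. -/
lemma dualValue_sparseQuad_eq {γ : ℝ} (hγ : 0 < γ) (a : Fin m → ℝ) (b : Fin n → ℝ)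
    (C : Matrix (Fin m) (Fin n) ℝ) (α : Fin m → ℝ) (β : Fin n → ℝ) :
    ((α ⬝ᵥ a + β ⬝ᵥ b : ℝ) : EReal)
      - ∑ j, conjugate (restrictOrthant (sparseQuad m γ 1)) (fun i => α i + β j - C i j)
      = ((semiDualObjective a b C α + ∑ j, ((maxEntry (fun i => α i - C i j) + β j) * b j
          - 1 / (2 * γ) * max (maxEntry (fun i => α i - C i j) + β j) 0 ^ 2) : ℝ) : EReal) := by
  have h : ∀ j, conjugate (restrictOrthant (sparseQuad m γ 1)) (fun i => α i + β j - C i j)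
      = ((1 / (2 * γ) * max (maxEntry (fun i => α i - C i j) + β j) 0 ^ 2 : ℝ) : EReal) := by
    intro j
    rw [conjugate_eq (isGreatest_conjugate_restrictOrthant_sparseQuad hγ _),
      ← maxEntry_add_const]
    simp only [add_sub_right_comm]
  simp only [h]
  rw [← coe_sum, ← EReal.coe_sub, Finset.sum_sub_distrib, semiDualObjective]
  simp only [add_mul, Finset.sum_add_distrib, dotProduct]
  congr 1
  simp only [mul_comm (b _)]
  ring

lemma isGreatest_dualValues_sparseQuad {γ : ℝ} (hγ : 0 < γ) {a : Fin m → ℝ}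
    {b : Fin n → ℝ} {C : Matrix (Fin m) (Fin n) ℝ} (hb : ∀ j, 0 ≤ b j) {α : Fin m → ℝ}
    (hα : ∀ α', semiDualObjective a b C α' ≤ semiDualObjective a b C α) :
    IsGreatest (dualValues (sparseQuad m γ 1) a b C)
      ((semiDualObjective a b C α + ∑ j, γ / 2 * b j ^ 2 : ℝ) : EReal) := by
  constructor
  -- This `β` makes `xⱼ = γ bⱼ`, the maximizer of `x bⱼ - [x]₊² / (2γ)`, whose value is `γ bⱼ² / 2`.
  · refine ⟨⟨α, fun j => γ * b j - maxEntry (fun i => α i - C i j)⟩, ?_⟩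
    refine (dualValue_sparseQuad_eq hγ a b C _ _).trans ?_
    congr 2
    refine Finset.sum_congr rfl fun j _ => ?_
    rw [add_sub_cancel, max_eq_left (mul_nonneg hγ.le (hb j))]
    field_simp; ring
  · rintro _ ⟨⟨α', β⟩, rfl⟩
    refine (dualValue_sparseQuad_eq hγ a b C α' β).trans_le ?_
    rw [EReal.coe_le_coe_iff]
    refine add_le_add (hα α') (Finset.sum_le_sum fun j _ => ?_)
    set x := maxEntry (fun i => α' i - C i j) + β j
    have h1 : x * b j ≤ max x 0 * b j := mul_le_mul_of_nonneg_right (le_max_left _ _) (hb j)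
    have h2 : 0 ≤ 1 / (2 * γ) * (γ * b j - max x 0) ^ 2 := by positivity
    have h3 : 1 / (2 * γ) * (γ * b j - max x 0) ^ 2
        = γ / 2 * b j ^ 2 - max x 0 * b j + 1 / (2 * γ) * max x 0 ^ 2 := by
      field_simp; ring
    linarith

end Duality

end SparseOT


open SparseOT

theorem proposition4 {m n : ℕ} [NeZero m] (γ : ℝ) (hγ : 0 < γ) :
    -- closed form of `Ω_+^*`, the supremum being a maximum
    (∀ s : Fin m → ℝ,
      conjugate (restrictOrthant (sparseQuad m γ 1)) s
          = ((1 / (2 * γ) * Finset.univ.sup' Finset.univ_nonempty (fun i => (max (s i) 0) ^ 2) : ℝ)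
              : EReal) ∧
      IsGreatest (conjugateValues (restrictOrthant (sparseQuad m γ 1)) s)
        (conjugate (restrictOrthant (sparseQuad m γ 1)) s)) ∧
    -- closed form of `Ω_b^*`, the supremum being a maximum
    (∀ (b : ℝ), 0 ≤ b → ∀ s : Fin m → ℝ,
      conjugate (restrictSimplex (sparseQuad m γ 1) b) s
          = ((b * Finset.univ.sup' Finset.univ_nonempty s - γ / 2 * b ^ 2 : ℝ) : EReal) ∧
      IsGreatest (conjugateValues (restrictSimplex (sparseQuad m γ 1) b) s)
        (conjugate (restrictSimplex (sparseQuad m γ 1) b) s)) ∧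
    (∀ (a : Fin m → ℝ) (b : Fin n → ℝ) (C : Matrix (Fin m) (Fin n) ℝ),
      a ∈ stdSimplex ℝ (Fin m) → b ∈ stdSimplex ℝ (Fin n) → (∀ i j, 0 ≤ C i j) →
      -- the chain of equalities
      (dual (sparseQuad m γ 1) a b C = semiDual (sparseQuad m γ 1) a b C ∧
        semiDual (sparseQuad m γ 1) a b C
          = semiDual 0 a b C + ((γ / 2 * ∑ j, b j ^ 2 : ℝ) : EReal) ∧
        semiDual 0 a b C + ((γ / 2 * ∑ j, b j ^ 2 : ℝ) : EReal)
          = primal 0 a b C + ((γ / 2 * ∑ j, b j ^ 2 : ℝ) : EReal)) ∧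
      -- the two expressions of the semi-dual objective agree
      (∀ α : Fin m → ℝ,
        primalConj (sparseQuad m γ 1) α b C
            = ∑ j, conjugate (restrictSimplex (sparseQuad m γ 1) (b j)) (fun i => α i - C i j) ∧
        primalConj 0 α b C
            = ∑ j, conjugate (restrictSimplex 0 (b j)) (fun i => α i - C i j)) ∧
      -- the values in the chain are attained
      IsGreatest (dualValues (sparseQuad m γ 1) a b C) (dual (sparseQuad m γ 1) a b C) ∧
      IsGreatest (semiDualValues (sparseQuad m γ 1) a b C) (semiDual (sparseQuad m γ 1) a b C) ∧
      IsGreatest (semiDualValues 0 a b C) (semiDual 0 a b C) ∧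
      IsLeast (primalValues 0 a b C) (primal 0 a b C)) := by
  have hΩ := isVertexExact_sparseQuad (m := m) hγ
  refine ⟨fun s => ?_, fun b hb s => ?_, fun a b C ha hb hC => ?_⟩
  · have h := isGreatest_conjugate_restrictOrthant_sparseQuad hγ s
    rw [← maxEntry_sq_max] at h
    rw [conjugate_eq h]
    exact ⟨rfl, h⟩
  · have h := hΩ.isGreatest_conjugate_restrictSimplex hb s
    rw [conjugate_eq h]
    exact ⟨rfl, h⟩
  · have hab : ∑ i, a i = ∑ j, b j := ha.2.trans hb.2.symm
    obtain ⟨α, hα, hP⟩ := exists_isMax_isLeast_primalValues_zero ha.1 hb.1 hab hC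
    have hD := isGreatest_dualValues_sparseQuad hγ hb.1 hα
    have hS := hΩ.isGreatest_semiDualValues hb.1 hα
    have hS0 := (isVertexExact_zero (m := m)).isGreatest_semiDualValues hb.1 hα
    rw [Finset.sum_const_zero, add_zero] at hS0
    have eD : dual (sparseQuad m γ 1) a b C = _ := hD.isLUB.sSup_eq
    have eS : semiDual (sparseQuad m γ 1) a b C = _ := hS.isLUB.sSup_eq
    have eS0 : semiDual 0 a b C = _ := hS0.isLUB.sSup_eq
    have eP : primal 0 a b C = _ := hP.isGLB.sInf_eq
    rw [eD, eS, eS0, eP]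
    refine ⟨⟨rfl, ?_, rfl⟩, fun α => ⟨?_, ?_⟩, hD, hS, hS0, hP⟩
    · rw [← EReal.coe_add, Finset.mul_sum]
    · rw [hΩ.primalConj_eq hb.1, coe_sum]
      exact Finset.sum_congr rfl fun j _ =>
        (conjugate_eq (hΩ.isGreatest_conjugate_restrictSimplex (hb.1 j) _)).symm
    · rw [isVertexExact_zero.primalConj_eq hb.1, coe_sum]
      exact Finset.sum_congr rfl fun j _ =>
        (conjugate_eq (isVertexExact_zero.isGreatest_conjugate_restrictSimplex (hb.1 j) _)).symm
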